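/- For real $a$ and an integer $k\ge 0$ let $(a)_k=a(a+1)\cdots(a+k-1)$ (with $(a)_0=1$). For an integer $n\ge 0$, real $\alpha,\beta$ and $z\in\mathbb C$ let $$P_n^{(\alpha,\beta)}(z)=\frac1{n!}\sum_{k=0}^n\binom nk\,(n+\alpha+\beta+1)_k\,(\alpha+k+1)_{n-k}\left(\frac{z-1}{2}\right)^k$$ be the Jacobi polynomial; for $\alpha>-1$ it equals $\frac{(\alpha+1)_n}{n!}\,{}_2F_1\!\left(-n,n+\alpha+\beta+1;\alpha+1;\frac{1-z}{2}\right)$. Let $n\ge 1$ be an integer and let $\alpha,\beta\ge -1$ be real. Then for $z=x+iy$ and all real $x,y$, $$y\,\frac{\partial}{\partial y}\left|P_n^{(\alpha,\beta)}(1-2z)\right|^2\;\ge\;\frac{2n\,(n+\alpha+\beta+1)_n(\alpha+1)_n}{n!\,n!}\,y^{2n}$$ and $$\frac{\partial^2}{\partial y^2}\left|P_n^{(\alpha,\beta)}(1-2z)\right|^2\;\ge\;\frac{2n(2n-1)\,(n+\alpha+\beta+1)_n(\alpha+1)_n}{n!\,n!}\,y^{2n-2}.$$ -/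

import Mathlib

/-- The Jacobi polynomial
`P_n^{(α,β)}(z) = (1/n!) ∑_{k=0}^n C(n,k) (n+α+β+1)_k (α+k+1)_{n-k} ((z-1)/2)^k`,
where `(a)_k` is the rising factorial. For `α > -1` this is
`(α+1)_n / n! * ₂F₁(-n, n+α+β+1; α+1; (1-z)/2)`, see `aeval_jacobiPoly`; in this form it makes
sense for all real `α`, `β` and is continuous in them. -/
noncomputable def jacobiPoly (n : ℕ) (α β : ℝ) : Polynomial ℝ :=
  ∑ k ∈ Finset.range (n + 1),
    Polynomial.C ((n.choose k : ℝ) * (ascPochhammer ℝ k).eval ((n : ℝ) + α + β + 1)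
        * (ascPochhammer ℝ (n - k)).eval (α + (k : ℝ) + 1) / (n.factorial : ℝ))
      * (Polynomial.C (1 / 2) * (Polynomial.X - 1)) ^ k

theorem aeval_jacobiPoly (n : ℕ) (α β : ℝ) (hα : -1 < α) (z : ℂ) :
    Polynomial.aeval z (jacobiPoly n α β)
      = ((ascPochhammer ℝ n).eval (α + 1) / (n.factorial : ℝ) : ℝ)
        * ordinaryHypergeometric (-(n : ℝ)) ((n : ℝ) + α + β + 1) (α + 1) ((1 - z) / 2) := by
  have hF : ordinaryHypergeometric (-(n : ℝ)) ((n : ℝ) + α + β + 1) (α + 1) ((1 - z) / 2)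
      = ∑ k ∈ Finset.range (n + 1), (((k.factorial : ℝ)⁻¹ * (ascPochhammer ℝ k).eval (-(n : ℝ))
        * (ascPochhammer ℝ k).eval ((n : ℝ) + α + β + 1)
        * ((ascPochhammer ℝ k).eval (α + 1))⁻¹ : ℝ)) • ((1 - z) / 2) ^ k := by
    rw [ordinaryHypergeometric_eq_tsum]
    refine tsum_eq_sum fun k hk => ?_
    have hnk : n < k := by
      rw [Finset.mem_range] at hk; omega
    rw [(ascPochhammer_eval_eq_zero_iff k (-(n : ℝ))).2 ⟨n, hnk, by simp⟩]
    simp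
  rw [hF, jacobiPoly, map_sum, Finset.mul_sum]
  refine Finset.sum_congr rfl fun k hk => ?_
  have hkn : k ≤ n := Nat.lt_succ_iff.1 (Finset.mem_range.1 hk)
  have hpos : (ascPochhammer ℝ k).eval (α + 1) ≠ 0 :=
    (ascPochhammer_pos k (α + 1) (by linarith)).ne'
  have hsplit : (ascPochhammer ℝ n).eval (α + 1) = (ascPochhammer ℝ k).eval (α + 1)
      * (ascPochhammer ℝ (n - k)).eval (α + (k : ℝ) + 1) := by
    have h := ascPochhammer_mul ℝ k (n - k)
    rw [Nat.add_sub_cancel' hkn] at h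
    rw [← h]
    simp [Polynomial.eval_comp, add_right_comm]
  have hneg : (ascPochhammer ℝ k).eval (-(n : ℝ))
      = (-1) ^ k * ((k.factorial : ℝ) * (n.choose k : ℝ)) := by
    rw [ascPochhammer_eval_neg_eq_descPochhammer, descPochhammer_eval_eq_descFactorial,
      Nat.descFactorial_eq_factorial_mul_choose]
    push_cast
    ring
  have hz : ((z - 1) / 2) ^ k = (-1) ^ k * ((1 - z) / 2) ^ k := by
    rw [← mul_pow]; congr 1; ring
  have hk0 : (k.factorial : ℝ) ≠ 0 := by positivity
  have hreal : (n.choose k : ℝ) * (ascPochhammer ℝ k).eval ((n : ℝ) + α + β + 1)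
        * (ascPochhammer ℝ (n - k)).eval (α + (k : ℝ) + 1) / (n.factorial : ℝ) * (-1) ^ k
      = (ascPochhammer ℝ n).eval (α + 1) / (n.factorial : ℝ)
        * ((k.factorial : ℝ)⁻¹ * (ascPochhammer ℝ k).eval (-(n : ℝ))
        * (ascPochhammer ℝ k).eval ((n : ℝ) + α + β + 1)
        * ((ascPochhammer ℝ k).eval (α + 1))⁻¹) := by
    rw [hsplit, hneg]; field_simp
  have hX : Polynomial.aeval z ((Polynomial.C (1 / 2 : ℝ) * (Polynomial.X - 1)) ^ k)
      = ((z - 1) / 2) ^ k := by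
    simp only [map_pow, map_mul, map_sub, Polynomial.aeval_C, Polynomial.aeval_X, map_one]
    congr 1
    simp
    ring
  rw [map_mul, hX, hz, Polynomial.aeval_C, Complex.real_smul, ← mul_assoc, ← mul_assoc,
    ← Complex.ofReal_mul, ← hreal]
  simp

/-- `|P_n^{(α,β)}(1 - 2z)|²` at `z = x + i y`, as a function of the real variables `x`, `y`. -/
noncomputable def jacobiAbsSq (n : ℕ) (α β x y : ℝ) : ℝ :=
  ‖Polynomial.aeval (1 - 2 * ((x : ℂ) + (y : ℂ) * Complex.I)) (jacobiPoly n α β)‖ ^ 2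

/-- The `y`-derivatives of `|P_n^{(α,β)}(1 - 2(x + i y))|²` exist to every order. -/
theorem contDiff_jacobiAbsSq (n : ℕ) (α β x : ℝ) :
    ContDiff ℝ (⊤ : ℕ∞) (fun y : ℝ => jacobiAbsSq n α β x y) := by
  have h1 : ContDiff ℝ (⊤ : ℕ∞) (fun y : ℝ => (1 - 2 * ((x : ℂ) + (y : ℂ) * Complex.I))) := by
    have : ContDiff ℝ (⊤ : ℕ∞) (fun y : ℝ => (y : ℂ)) := Complex.ofRealCLM.contDiff
    fun_prop
  have h2 : ContDiff ℝ (⊤ : ℕ∞) (fun z : ℂ => Polynomial.aeval z (jacobiPoly n α β)) :=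
    (Polynomial.contDiff_aeval (𝕜 := ℂ) (jacobiPoly n α β) (⊤ : ℕ∞)).restrict_scalars ℝ
  exact (h2.comp h1).norm_sq ℝ

/-! Substitute `t = -z`, so that `P_n(1 - 2z)` becomes the real polynomial `J_n(t) = P_n(1 + 2t)`.
It suffices that `J_n` is real-rooted: then `|J_n(x + iy)|²` is `c² ∏ ((x - r)² + y²)`, a polynomial
in `y²` with nonnegative coefficients, so each term contributes nonnegatively to both derivative
expressions and the `y ^ (2n)` term alone gives the bounds. Its coefficient is `((n+α+β+1)_n /
n!)²`, at least the stated constant because `n + β ≥ 0`.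

Real-rootedness goes by induction on `n`: `C_mul_shiftedJacobi_succ` produces `J_{n+1}^{(α,β)}` from
`J_n^{(α+1,β+1)}` by a first-order operator, which preserves real roots when `α + 1, β + 1 ≥ 0`. -/

/-! ### A first-order operator preserving real-rootedness -/

open Polynomial in
/-- If `Q` is real-rooted and `a, b ≥ 0`, then so is `X (1 + X) Q' + (a + (a + b) X) Q`: off the
real axis, all summands of `Q' / Q + a / z + b / (z + 1)` have imaginary part of the same sign. -/
theorem Polynomial.Splits.X_mul_one_add_X_mul_derivative_add {Q : ℝ[X]} (hQ : Q.Splits) {a b : ℝ}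
    (ha : 0 ≤ a) (hb : 0 ≤ b) :
    (X * (1 + X) * derivative Q + (C a + C (a + b) * X) * Q).Splits := by
  set R := X * (1 + X) * derivative Q + (C a + C (a + b) * X) * Q with hR
  -- This case does occur: `Q` constant and `a = b = 0`.
  by_cases hR0 : R = 0
  · rw [hR0]; exact Splits.zero
  have hQ0 : Q ≠ 0 := by
    rintro rfl
    exact hR0 (by simp [hR])
  refine Splits.of_splits_map (algebraMap ℝ ℂ) (IsAlgClosed.splits _) fun z hz => ?_
  by_contra hzr
  have him : z.im ≠ 0 := fun h => hzr ⟨z.re, Complex.ext (by simp) (by simp [h])⟩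
  set q := Q.map (algebraMap ℝ ℂ) with hq
  have hqz : q.eval z ≠ 0 := fun h => hzr (hQ.mem_range_of_isRoot hQ0 h)
  have hz0 : z ≠ 0 := by
    rintro rfl
    simp at him
  have hz1 : z + 1 ≠ 0 := by
    intro h
    have := congrArg Complex.im h
    simp at this
    exact him this
  have hRz : z * (1 + z) * (derivative q).eval z + (a + (a + b) * z) * q.eval z = 0 := by
    have := isRoot_of_mem_roots hz
    simpa [hR, hq, derivative_map, IsRoot] using this
  have hlog : (derivative q).eval z / q.eval z + a * (1 / (z - 0)) + b * (1 / (z - (-1 : ℝ)))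
      = 0 := by
    have h : (derivative q).eval z / q.eval z + a * (1 / z) + b * (1 / (z + 1))
        = (z * (1 + z) * (derivative q).eval z + (a + (a + b) * z) * q.eval z)
          / (z * (z + 1) * q.eval z) := by
      field_simp
      ring
    simpa [hRz] using h
  rw [(hQ.map _).eval_derivative_div_eval_of_ne_zero hqz, hQ.roots_map, Multiset.map_map] at hlog
  have hterm : ∀ r : ℝ, z.im * (1 / (z - r)).im < 0 := by
    intro r
    have hn : 0 < Complex.normSq (z - r) := by
      rw [Complex.normSq_pos]
      intro h
      have := congrArg Complex.im h
      simp at this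
      exact him this
    have : z.im * (1 / (z - r)).im = -(z.im ^ 2 / Complex.normSq (z - r)) := by
      rw [one_div, Complex.inv_im]
      simp
      ring
    rw [this]
    have := sq_pos_of_ne_zero him
    have := div_pos this hn
    linarith
  have hsum : ∀ s : Multiset ℝ, s ≠ 0 →
      z.im * ((s.map fun r : ℝ => 1 / (z - (r : ℂ))).sum).im < 0 := by
    intro s
    induction s using Multiset.induction_on with
    | empty => simp
    | cons r s ih =>
      intro _
      rw [Multiset.map_cons, Multiset.sum_cons, Complex.add_im, mul_add]
      rcases eq_or_ne s 0 with rfl | hs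
      · simpa using hterm r
      · exact add_neg (hterm r) (ih hs)
  have him0 := congrArg (fun w : ℂ => z.im * w.im) hlog
  have h0 := hterm 0
  have h1 := hterm (-1)
  simp only [Complex.add_im, Complex.im_ofReal_mul, Complex.zero_im, mul_zero] at him0
  rw [Complex.ofReal_zero] at h0
  have hS : z.im * ((Q.roots.map fun r : ℝ => 1 / (z - (r : ℂ))).sum).im
      + a * (z.im * (1 / (z - 0)).im) + b * (z.im * (1 / (z - (-1 : ℝ))).im) = 0 := by
    rw [← him0]
    simp only [Function.comp_def, Complex.coe_algebraMap]
    ring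
  have ha' := mul_nonpos_of_nonneg_of_nonpos ha h0.le
  have hb' := mul_nonpos_of_nonneg_of_nonpos hb h1.le
  -- No summand of `hS` is positive, and the first is strictly negative once `Q` has a root. Without
  -- roots, `a = b = 0` and `Q` is constant, so `R = 0`.
  rcases eq_or_ne Q.roots 0 with hr | hr
  · rw [hr] at hS
    simp only [Multiset.map_zero, Multiset.sum_zero, Complex.zero_im, mul_zero, zero_add] at hS
    have ha0 : a = 0 := by
      by_contra h
      have := mul_neg_of_pos_of_neg (lt_of_le_of_ne ha (Ne.symm h)) h0
      linarith
    have hb0 : b = 0 := by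
      by_contra h
      have := mul_neg_of_pos_of_neg (lt_of_le_of_ne hb (Ne.symm h)) h1
      linarith
    have hdeg : Q.natDegree = 0 := by rw [hQ.natDegree_eq_card_roots, hr, Multiset.card_zero]
    apply hR0
    rw [hR, derivative_of_natDegree_zero hdeg, ha0, hb0]
    simp
  · have := hsum _ hr
    linarith

/-! ### Real-rootedness of Jacobi polynomials -/

/-- The coefficient of `t ^ k` in `P_n^{(α,β)}(1 + 2t)`. -/
noncomputable def shiftedJacobiCoeff (n : ℕ) (α β : ℝ) (k : ℕ) : ℝ :=
  (n.choose k : ℝ) * (ascPochhammer ℝ k).eval ((n : ℝ) + α + β + 1)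
    * (ascPochhammer ℝ (n - k)).eval (α + (k : ℝ) + 1) / (n.factorial : ℝ)

/-- The polynomial `P_n^{(α,β)}(1 + 2t)` in `t`. -/
noncomputable def shiftedJacobi (n : ℕ) (α β : ℝ) : Polynomial ℝ :=
  ∑ k ∈ Finset.range (n + 1), Polynomial.monomial k (shiftedJacobiCoeff n α β k)

theorem coeff_shiftedJacobi (n : ℕ) (α β : ℝ) (k : ℕ) :
    (shiftedJacobi n α β).coeff k = shiftedJacobiCoeff n α β k := by
  rw [shiftedJacobi, Polynomial.finsetSum_coeff]
  simp only [Polynomial.coeff_monomial, Finset.sum_ite_eq', Finset.mem_range]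
  split_ifs with h
  · rfl
  · rw [shiftedJacobiCoeff, Nat.choose_eq_zero_of_lt (by omega)]
    simp

theorem natDegree_shiftedJacobi_le (n : ℕ) (α β : ℝ) : (shiftedJacobi n α β).natDegree ≤ n := by
  rw [Polynomial.natDegree_le_iff_coeff_eq_zero]
  intro k hk
  rw [coeff_shiftedJacobi, shiftedJacobiCoeff, Nat.choose_eq_zero_of_lt hk]
  simp

theorem aeval_jacobiPoly_one_sub_two_mul (n : ℕ) (α β : ℝ) (z : ℂ) :
    Polynomial.aeval (1 - 2 * z) (jacobiPoly n α β)
      = Polynomial.aeval (-z) (shiftedJacobi n α β) := by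
  rw [jacobiPoly, shiftedJacobi, map_sum, map_sum]
  refine Finset.sum_congr rfl fun k _ => ?_
  rw [Polynomial.aeval_monomial, map_mul, Polynomial.aeval_C, shiftedJacobiCoeff]
  congr 1
  simp only [map_pow, map_mul, map_sub, Polynomial.aeval_C, Polynomial.aeval_X, map_one]
  congr 1
  simp

theorem ascPochhammer_eval_succ_left (k : ℕ) (x : ℝ) :
    (ascPochhammer ℝ (k + 1)).eval x = x * (ascPochhammer ℝ k).eval (x + 1) := by
  simp [ascPochhammer_succ_left, Polynomial.eval_comp]

theorem succ_mul_shiftedJacobiCoeff_zero (n : ℕ) (α β : ℝ) :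
    ((n : ℝ) + 1) * shiftedJacobiCoeff (n + 1) α β 0
      = (α + 1) * shiftedJacobiCoeff n (α + 1) (β + 1) 0 := by
  simp only [shiftedJacobiCoeff, Nat.sub_zero, Nat.factorial_succ]
  rw [ascPochhammer_eval_succ_left]
  push_cast
  have : (n.factorial : ℝ) ≠ 0 := by positivity
  simp
  field_simp

theorem succ_mul_shiftedJacobiCoeff_succ (n : ℕ) (α β : ℝ) (k : ℕ) :
    ((n : ℝ) + 1) * shiftedJacobiCoeff (n + 1) α β (k + 1)
      = ((k : ℝ) + 1 + (α + 1)) * shiftedJacobiCoeff n (α + 1) (β + 1) (k + 1)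
        + ((k : ℝ) + (α + 1 + (β + 1))) * shiftedJacobiCoeff n (α + 1) (β + 1) k := by
  have hf : (n.factorial : ℝ) ≠ 0 := by positivity
  have hchoose : ((n + 1).choose (k + 1) : ℝ) = n.choose k + n.choose (k + 1) := by
    rw [Nat.choose_succ_succ]; push_cast; rfl
  have hmul : (n.choose (k + 1) : ℝ) * (k + 1) = n.choose k * (n - k) := by
    rcases le_or_gt k n with h | h
    · have := Nat.choose_succ_right_eq n k
      rw [← Nat.cast_sub h]
      exact_mod_cast this
    · simp [Nat.choose_eq_zero_of_lt h, Nat.choose_eq_zero_of_lt (Nat.lt_succ_of_lt h)]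
  simp only [shiftedJacobiCoeff, Nat.factorial_succ, Nat.add_sub_add_right]
  have e1 : (ascPochhammer ℝ (k + 1)).eval (((n + 1 : ℕ) : ℝ) + α + β + 1)
      = ((n : ℝ) + α + β + 2) * (ascPochhammer ℝ k).eval ((n : ℝ) + (α + 1) + (β + 1) + 1) := by
    rw [ascPochhammer_eval_succ_left]
    push_cast
    ring_nf
  have e2 : (ascPochhammer ℝ (k + 1)).eval ((n : ℝ) + (α + 1) + (β + 1) + 1)
      = (ascPochhammer ℝ k).eval ((n : ℝ) + (α + 1) + (β + 1) + 1)
        * ((n : ℝ) + α + β + 3 + k) := by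
    rw [ascPochhammer_succ_eval]
    ring
  -- The binomial factor covers `k ≥ n`, where the subtraction `n - (k + 1)` truncates.
  have e3 : (n.choose (k + 1) : ℝ) * (((k : ℝ) + 1 + (α + 1))
        * (ascPochhammer ℝ (n - (k + 1))).eval (α + 1 + ((k + 1 : ℕ) : ℝ) + 1))
      = n.choose (k + 1) * (ascPochhammer ℝ (n - k)).eval (α + 1 + (k : ℝ) + 1) := by
    rcases lt_or_ge k n with h | h
    · obtain ⟨m, rfl⟩ : ∃ m, n = k + 1 + m := ⟨n - (k + 1), by omega⟩
      rw [show k + 1 + m - (k + 1) = m by omega, show k + 1 + m - k = m + 1 by omega,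
        ascPochhammer_eval_succ_left]
      push_cast
      ring_nf
    · simp [Nat.choose_eq_zero_of_lt (Nat.lt_succ_of_le h)]
  have e4 : α + ((k + 1 : ℕ) : ℝ) + 1 = α + 1 + (k : ℝ) + 1 := by push_cast; ring
  rw [e1, e2, e4, hchoose]
  set A := (ascPochhammer ℝ k).eval ((n : ℝ) + (α + 1) + (β + 1) + 1)
  set B := (ascPochhammer ℝ (n - k)).eval (α + 1 + (k : ℝ) + 1)
  set D := (ascPochhammer ℝ (n - (k + 1))).eval (α + 1 + ((k + 1 : ℕ) : ℝ) + 1)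
  push_cast
  field_simp
  linear_combination (-A * ((n : ℝ) + α + β + 3 + k)) * e3 - A * B * hmul

-- This is one derivative in Rodrigues' formula `n! t^α (1+t)^β J_n^{(α,β)} = D^n [t^(n+α)
-- (1+t)^(n+β)]`: it says `(n+1) t^α (1+t)^β J_{n+1}^{(α,β)} = D [t^(α+1) (1+t)^(β+1)
-- J_n^{(α+1,β+1)}]`. The proof compares coefficients.
open Polynomial in
theorem C_mul_shiftedJacobi_succ (n : ℕ) (α β : ℝ) :
    C ((n : ℝ) + 1) * shiftedJacobi (n + 1) α β
      = X * (1 + X) * derivative (shiftedJacobi n (α + 1) (β + 1))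
        + (C (α + 1) + C (α + 1 + (β + 1)) * X) * shiftedJacobi n (α + 1) (β + 1) := by
  set J := shiftedJacobi n (α + 1) (β + 1) with hJ
  have h : X * (1 + X) * derivative J + (C (α + 1) + C (α + 1 + (β + 1)) * X) * J
      = X * (derivative J + X * derivative J + C (α + 1 + (β + 1)) * J) + C (α + 1) * J := by
    ring
  rw [h]
  ext k
  rcases k with _ | k
  · simp only [coeff_add, mul_coeff_zero, coeff_X_zero, zero_mul, zero_add, hJ,
      coeff_shiftedJacobi]
    simpa using succ_mul_shiftedJacobiCoeff_zero n α β
  · have hX : (X * derivative J).coeff k = k * J.coeff k := by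
      rcases k with _ | k
      · simp
      · rw [coeff_X_mul, coeff_derivative]; push_cast; ring
    rw [coeff_add, coeff_X_mul, coeff_add, coeff_add, hX, coeff_derivative, coeff_C_mul,
      coeff_C_mul, coeff_C_mul, hJ, coeff_shiftedJacobi, coeff_shiftedJacobi, coeff_shiftedJacobi,
      succ_mul_shiftedJacobiCoeff_succ]
    ring

/-- The parameters are quantified inside the induction because each step raises both by one. -/
theorem splits_shiftedJacobi (n : ℕ) : ∀ α β : ℝ, -1 ≤ α → -1 ≤ β →
    (shiftedJacobi n α β).Splits := by
  induction n with
  | zero =>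
    intro α β _ _
    exact Polynomial.Splits.of_natDegree_eq_zero
      (Nat.le_zero.1 (natDegree_shiftedJacobi_le 0 α β))
  | succ n ih =>
    intro α β hα hβ
    have hn : ((n : ℝ) + 1) ≠ 0 := by positivity
    have h := ((ih (α + 1) (β + 1) (by linarith) (by linarith)).X_mul_one_add_X_mul_derivative_add
      (a := α + 1) (b := β + 1) (by linarith) (by linarith)).C_mul ((n : ℝ) + 1)⁻¹
    rwa [← C_mul_shiftedJacobi_succ, ← mul_assoc, ← Polynomial.C_mul, inv_mul_cancel₀ hn,
      Polynomial.C_1, one_mul] at h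

/-! ### Squared modulus along vertical lines -/

open Polynomial in
theorem coeff_prod_X_add_C_nonneg (s : Multiset ℝ) (hs : ∀ r ∈ s, 0 ≤ r) (k : ℕ) :
    0 ≤ ((s.map fun r => X + C r).prod).coeff k := by
  induction s using Multiset.induction_on generalizing k with
  | empty =>
    rw [Multiset.map_zero, Multiset.prod_zero, coeff_one]
    split_ifs <;> norm_num
  | cons r s ih =>
    have ih' := ih fun t ht => hs t (Multiset.mem_cons_of_mem ht)
    rw [Multiset.map_cons, Multiset.prod_cons, add_mul, coeff_add, coeff_C_mul]
    refine add_nonneg ?_ (mul_nonneg (hs r (Multiset.mem_cons_self r s)) (ih' k))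
    rcases k with _ | k
    · simp
    · rw [coeff_X_mul]; exact ih' k

open Polynomial in
/-- For a real-rooted `f`, `|f(x + i y)|²` is a polynomial in `y²` with nonnegative
coefficients. -/
theorem Polynomial.Splits.exists_norm_aeval_sq_eq {f : ℝ[X]} (hf : f.Splits) {n : ℕ}
    (hn : f.natDegree ≤ n) (x : ℝ) :
    ∃ q : ℝ[X], q.natDegree ≤ n ∧ (∀ k, 0 ≤ q.coeff k) ∧ q.coeff n = f.coeff n ^ 2 ∧
      ∀ y : ℝ, ‖aeval ((x : ℂ) + (y : ℂ) * Complex.I) f‖ ^ 2 = q.eval (y ^ 2) := by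
  set s := f.roots.map fun r => (x - r) ^ 2 with hs
  set p := (s.map fun r => X + C r).prod with hp
  have hmonic : p.Monic := monic_multiset_prod_of_monic _ _ fun r _ => monic_X_add_C r
  have hdeg : p.natDegree = f.natDegree := by
    rw [hf.natDegree_eq_card_roots, hp, natDegree_multiset_prod_of_monic]
    · simp only [Multiset.map_map, Function.comp_def, natDegree_X_add_C]
      simp [hs]
    · simp only [Multiset.mem_map]
      rintro _ ⟨r, _, rfl⟩
      exact monic_X_add_C r
  refine ⟨C (f.leadingCoeff ^ 2) * p, (natDegree_C_mul_le _ _).trans (hdeg.trans_le hn),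
    fun k => ?_, ?_, fun y => ?_⟩
  · rw [coeff_C_mul]
    refine mul_nonneg (sq_nonneg _) (coeff_prod_X_add_C_nonneg _ ?_ _)
    simp only [hs, Multiset.mem_map]
    rintro _ ⟨r, _, rfl⟩
    positivity
  · rw [coeff_C_mul]
    -- The degree may drop below `n`, as for `n = 1`, `α = β = -1`; both coefficients are then zero.
    rcases hn.lt_or_eq with h | h
    · rw [coeff_eq_zero_of_natDegree_lt h, coeff_eq_zero_of_natDegree_lt (hdeg.trans_lt h)]
      simp
    · rw [← h, ← hdeg, hmonic.coeff_natDegree, hdeg, coeff_natDegree, mul_one]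
  · have hev : ∀ t : Multiset ℝ,
        ‖(t.map fun r : ℝ => (x : ℂ) + (y : ℂ) * Complex.I - (r : ℂ)).prod‖ ^ 2
          = (((t.map fun r => (x - r) ^ 2).map fun r => X + C r).prod).eval (y ^ 2) := by
      intro t
      induction t using Multiset.induction_on with
      | empty => simp
      | cons r t ih =>
        simp only [Multiset.map_cons, Multiset.prod_cons, norm_mul, mul_pow, eval_mul, ih]
        congr 1
        rw [← Complex.normSq_eq_norm_sq, Complex.normSq_apply]
        simp
        ring
    rw [← eval_map_algebraMap, (hf.map (algebraMap ℝ ℂ)).eval_eq_prod_roots, hf.roots_map,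
      Multiset.map_map, norm_mul, mul_pow, eval_mul, eval_C, leadingCoeff_map]
    congr 1
    · simp
    · exact hev f.roots

open Polynomial in
/-- Lower bounds for the derivatives of `t ↦ q(t²)` when `q` has nonnegative coefficients. -/
theorem le_deriv_eval_sq {q : ℝ[X]} {n : ℕ} (hdeg : q.natDegree ≤ n)
    (hq : ∀ k, 0 ≤ q.coeff k) (y : ℝ) :
    2 * n * q.coeff n * y ^ (2 * n) ≤ y * deriv (fun t => q.eval (t ^ 2)) y ∧
      2 * n * (2 * n - 1) * q.coeff n * y ^ (2 * n - 2)
        ≤ iteratedDeriv 2 (fun t => q.eval (t ^ 2)) y := by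
  have hfun : (fun t : ℝ => q.eval (t ^ 2))
      = fun t => (∑ k ∈ Finset.range (n + 1), monomial (2 * k) (q.coeff k)).eval t := by
    ext t
    rw [eval_eq_sum_range' (Nat.lt_succ_of_le hdeg), eval_finsetSum]
    refine Finset.sum_congr rfl fun k _ => ?_
    rw [eval_monomial, pow_mul]
  have hd : ∀ p : ℝ[X], deriv (fun t => p.eval t) = fun t => (derivative p).eval t :=
    fun p => funext fun t => p.deriv
  have hmem : n ∈ Finset.range (n + 1) := Finset.self_mem_range_succ n
  -- The factor `k` hides the truncation of `2 * k - 1` at `k = 0`.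
  have hcast : ∀ k : ℕ, (k : ℝ) * ((2 * k - 1 : ℕ) : ℝ) = k * (2 * k - 1) := by
    intro k
    rcases k with _ | k
    · simp
    · rw [Nat.cast_sub (by omega)]; push_cast; ring
  rw [hfun, iteratedDeriv_succ, iteratedDeriv_one, hd, hd]
  simp only [derivative_sum, derivative_monomial, eval_finsetSum, eval_monomial]
  constructor
  · have h : ∀ k : ℕ, y * (q.coeff k * ((2 * k : ℕ) : ℝ) * y ^ (2 * k - 1))
        = 2 * k * q.coeff k * y ^ (2 * k) := by
      intro k
      rcases k with _ | k
      · simp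
      · rw [show 2 * (k + 1) = 2 * (k + 1) - 1 + 1 by omega, pow_succ]
        simp
        ring
    rw [Finset.mul_sum]
    simp only [h]
    refine Finset.single_le_sum (f := fun k : ℕ => 2 * (k : ℝ) * q.coeff k * y ^ (2 * k))
      (fun k _ => ?_) hmem
    have := hq k
    rw [pow_mul]
    positivity
  · have h : ∀ k : ℕ, q.coeff k * ((2 * k : ℕ) : ℝ) * ((2 * k - 1 : ℕ) : ℝ) * y ^ (2 * k - 1 - 1)
        = 2 * k * (2 * k - 1) * q.coeff k * y ^ (2 * k - 2) := by
      intro k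
      rw [Nat.sub_sub]
      push_cast
      linear_combination (2 * q.coeff k * y ^ (2 * k - 2)) * hcast k
    simp only [h]
    refine Finset.single_le_sum
      (f := fun k : ℕ => 2 * (k : ℝ) * (2 * k - 1) * q.coeff k * y ^ (2 * k - 2))
      (fun k _ => ?_) hmem
    have := hq k
    rw [show 2 * k - 2 = 2 * (k - 1) by omega, pow_mul, mul_assoc 2, ← hcast]
    positivity

/-! ### Comparison of constants and conclusion -/

theorem ascPochhammer_eval_nonneg_and_mono (n : ℕ) {s t : ℝ} (hs : 0 ≤ s) (hst : s ≤ t) :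
    0 ≤ (ascPochhammer ℝ n).eval s ∧ (ascPochhammer ℝ n).eval s ≤ (ascPochhammer ℝ n).eval t := by
  induction n with
  | zero => simp
  | succ n ih =>
    rw [ascPochhammer_succ_eval, ascPochhammer_succ_eval]
    have hn : (0 : ℝ) ≤ n := n.cast_nonneg
    exact ⟨mul_nonneg ih.1 (by linarith),
      mul_le_mul ih.2 (by linarith) (by linarith) (ih.1.trans ih.2)⟩

theorem mainTheorem7 (n : ℕ) (hn : 1 ≤ n) (α β : ℝ) (hα : -1 ≤ α) (hβ : -1 ≤ β) (x y : ℝ) :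
    (2 * (n : ℝ) * (ascPochhammer ℝ n).eval ((n : ℝ) + α + β + 1)
        * (ascPochhammer ℝ n).eval (α + 1) / ((n.factorial : ℝ) * (n.factorial : ℝ))
        * y ^ (2 * n)
      ≤ y * deriv (fun t : ℝ => jacobiAbsSq n α β x t) y) ∧
    (2 * (n : ℝ) * (2 * (n : ℝ) - 1) * (ascPochhammer ℝ n).eval ((n : ℝ) + α + β + 1)
        * (ascPochhammer ℝ n).eval (α + 1) / ((n.factorial : ℝ) * (n.factorial : ℝ))
        * y ^ (2 * n - 2)
      ≤ iteratedDeriv 2 (fun t : ℝ => jacobiAbsSq n α β x t) y) := by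
  obtain ⟨q, hdeg, hq, hqn, hev⟩ := (splits_shiftedJacobi n α β hα hβ).exists_norm_aeval_sq_eq
    (natDegree_shiftedJacobi_le n α β) (-x)
  have hfun : (fun t : ℝ => jacobiAbsSq n α β x t) = fun t => q.eval (t ^ 2) := by
    ext t
    -- The argument is `-z = -x + i(-t)`, hence the base point `-x` and the sign change in `t`.
    rw [jacobiAbsSq, aeval_jacobiPoly_one_sub_two_mul, ← neg_sq t, ← hev]
    congr 3
    push_cast
    ring_nf
  have hn1 : (1 : ℝ) ≤ n := by exact_mod_cast hn
  obtain ⟨h0, h1⟩ := ascPochhammer_eval_nonneg_and_mono n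
    (show 0 ≤ α + 1 by linarith) (show α + 1 ≤ (n : ℝ) + α + β + 1 by linarith)
  set A := (ascPochhammer ℝ n).eval ((n : ℝ) + α + β + 1)
  set B := (ascPochhammer ℝ n).eval (α + 1)
  have hA : q.coeff n = A * A / ((n.factorial : ℝ) * (n.factorial : ℝ)) := by
    rw [hqn, coeff_shiftedJacobi, shiftedJacobiCoeff]
    simp [A]
    ring
  have hAB : A * B / ((n.factorial : ℝ) * (n.factorial : ℝ)) ≤ q.coeff n := by
    rw [hA]
    have := mul_le_mul_of_nonneg_left h1 (h0.trans h1)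
    gcongr
  obtain ⟨hd1, hd2⟩ := le_deriv_eval_sq hdeg hq y
  rw [hfun]
  have hy1 : 0 ≤ y ^ (2 * n) := by rw [pow_mul]; positivity
  have hy2 : 0 ≤ y ^ (2 * n - 2) := by
    rw [show 2 * n - 2 = 2 * (n - 1) by omega, pow_mul]; positivity
  have hc1 : 0 ≤ 2 * (n : ℝ) := by linarith
  have hc2 : 0 ≤ 2 * (n : ℝ) * (2 * n - 1) := mul_nonneg hc1 (by linarith)
  constructor
  · refine le_trans ?_ hd1
    rw [mul_assoc _ A B, mul_div_assoc]
    exact mul_le_mul_of_nonneg_right (mul_le_mul_of_nonneg_left hAB hc1) hy1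
  · refine le_trans ?_ hd2
    rw [mul_assoc _ A B, mul_div_assoc]
    exact mul_le_mul_of_nonneg_right (mul_le_mul_of_nonneg_left hAB hc2) hy2
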